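/- Let $(\mathcal R,\mu)$ be a $\sigma$-finite measure space and let $\mathcal M$ be the set of all extended complex-valued measurable functions on $\mathcal R$, functions equal $\mu$-a.e. being identified; $\mathcal M_+$ is the set of non-negative functions in $\mathcal M$. For $f\in\mathcal M$ and $s,t\in[0,\infty)$ put $f_*(s)=\mu(\{|f|>s\})$ and $f^*(t)=\inf\{s\in[0,\infty):f_*(s)\le t\}$. Assume that $(\mathcal R,\mu)$ is resonant, i.e. for all $f,g\in\mathcal M$ $$\sup_{\tilde g\in\mathcal M,\ \tilde g^*=g^*}\int_{\mathcal R}|f\tilde g|\,d\mu=\int_0^\infty f^*(t)g^*(t)\,dt .$$ Let $\|\cdot\|_X:\mathcal M\to[0,\infty]$ be a rearrangement-invariant quasi-Banach function norm satisfying (P5). That is, $\|f\|_X=\|\,|f|\,\|_X$ for all $f\in\mathcal M$, $\|f\|_X=\|g\|_X$ whenever $f^*=g^*$, and on $\mathcal M_+$: - $\|af\|_X=|a|\,\|f\|_X$ for $a\in\mathbb C$; $\|f\|_X=0$ if and only if $f=0$ $\mu$-a.e.; and there is a constant $C\ge1$ with $\|f+g\|_X\le C(\|f\|_X+\|g\|_X)$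 for all $f,g$; - $f\le g$ $\mu$-a.e. implies $\|f\|_X\le\|g\|_X$; - $f_n\uparrow f$ $\mu$-a.e. implies $\|f_n\|_X\uparrow\|f\|_X$; - $\|\chi_E\|_X<\infty$ for every measurable $E$ with $\mu(E)<\infty$; - (P5) for every measurable $E$ with $\mu(E)<\infty$ there is $C_E<\infty$ with $\int_E f\,d\mu\le C_E\|f\|_X$ for all $f\in\mathcal M_+$. Let $X=\{f\in\mathcal M:\|f\|_X<\infty\}$, and let $X'=\{\varphi\in\mathcal M:\|\varphi\|_{X'}<\infty\}$ be its associate space, where $\|\varphi\|_{X'}=\sup_{g\in X}\|g\|_X^{-1}\int_{\mathcal R}|\varphi g|\,d\mu$ (with $0/0=0$ and $a/0=\infty$ for $a>0$). Let $\xi$ be the locally convex topology on $X$ induced by the family of seminorms $|f|_\varphi=\int_0^\infty\varphi^*(t)f^*(t)\,dt$, $\varphi\in X'$. Assume that $X$ has the (ACR) property, i.e. $\lim_{t\to\infty}f^*(t)=0$ for every $f\in X$. Then $(X,\xi)^*=X'$ in the following sense: for all $\varphi\in X'$ and $f\in X$ the product $\varphi f$ is integrable, and a linear functional $\alpha:X\to\mathbb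 C$ is $\xi$-continuous if and only if there is a function $\varphi\in X'$, necessarily unique, such that $$\alpha(f)=\int_{\mathcal R}\varphi f\,d\mu\qquad\text{for all } f\in X .$$ -/

import Mathlib

open MeasureTheory Filter Topology
open scoped ENNReal NNReal

namespace RIFunctionSpace

variable {R : Type*} [MeasurableSpace R]

/-! Functionals on measurable functions are given by their values on moduli, that is, on
measurable functions with values in `[0, ∞]`; the value at a complex function `f` is the value
at `|f|`. -/

/-- The distribution function `s ↦ μ {|f| > s}` of a function with modulus `f`. -/
noncomputable def distribution (μ : Measure R) (f : R → ℝ≥0∞) (s : ℝ≥0) : ℝ≥0∞ :=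
  μ {x | (s : ℝ≥0∞) < f x}

/-- The non-increasing rearrangement `f^*(t) = inf {s ∈ [0, ∞) ; f_*(s) ≤ t}` for `t ∈ [0, ∞)`
(with `inf ∅ = ∞`); only `t ≥ 0` is ever used. -/
noncomputable def rearrangement (μ : Measure R) (f : R → ℝ≥0∞) (t : ℝ) : ℝ≥0∞ :=
  ⨅ (s : ℝ≥0) (_ : distribution μ f s ≤ ENNReal.ofReal t), (s : ℝ≥0∞)

/-- Equimeasurability: `f^* = g^*` on `[0, ∞)`. -/
def Equimeasurable (μ : Measure R) (f g : R → ℝ≥0∞) : Prop :=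
  ∀ t : ℝ, 0 ≤ t → rearrangement μ f t = rearrangement μ g t

/-- `∫_0^∞ f^* g^* dλ`. -/
noncomputable def rearrangementPairing (μ : Measure R) (f g : R → ℝ≥0∞) : ℝ≥0∞ :=
  ∫⁻ t in Set.Ici (0 : ℝ), rearrangement μ f t * rearrangement μ g t

/-- Resonance of a measure: equality in the Hardy--Littlewood inequality after taking the
supremum over all functions equimeasurable with one of the factors. -/
def IsResonant (μ : Measure R) : Prop :=
  ∀ f g : R → ℝ≥0∞, Measurable f → Measurable g →
    (⨆ (h : R → ℝ≥0∞) (_ : Measurable h) (_ : Equimeasurable μ h g), ∫⁻ x, f x * h x ∂μ)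
      = rearrangementPairing μ f g

/-- Quasi-Banach function norms. -/
structure IsQuasiBanachFunctionNorm (μ : Measure R) (ρ : (R → ℝ≥0∞) → ℝ≥0∞) : Prop where
  homogeneous : ∀ (a : ℝ≥0) (f : R → ℝ≥0∞), Measurable f →
    ρ (fun x => (a : ℝ≥0∞) * f x) = (a : ℝ≥0∞) * ρ f
  eq_zero_iff : ∀ f : R → ℝ≥0∞, Measurable f → (ρ f = 0 ↔ f =ᵐ[μ] 0)
  quasi_subadditive : ∃ C : ℝ≥0, 1 ≤ C ∧ ∀ f g : R → ℝ≥0∞, Measurable f → Measurable g →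
    ρ (fun x => f x + g x) ≤ (C : ℝ≥0∞) * (ρ f + ρ g)
  lattice : ∀ f g : R → ℝ≥0∞, Measurable f → Measurable g → f ≤ᵐ[μ] g → ρ f ≤ ρ g
  fatou : ∀ (f : ℕ → R → ℝ≥0∞) (g : R → ℝ≥0∞), (∀ n, Measurable (f n)) → Measurable g →
    (∀ᵐ x ∂μ, Monotone (fun n => f n x) ∧ Tendsto (fun n => f n x) atTop (𝓝 (g x))) →
    Monotone (fun n => ρ (f n)) ∧ Tendsto (fun n => ρ (f n)) atTop (𝓝 (ρ g))
  indicator_lt_top : ∀ E : Set R, MeasurableSet E → μ E < ∞ → ρ (E.indicator 1) < ∞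

/-- The axiom (P5): functions are integrable over sets of finite measure, with a bound by the
functional. -/
def HasP5 (μ : Measure R) (ρ : (R → ℝ≥0∞) → ℝ≥0∞) : Prop :=
  ∀ E : Set R, MeasurableSet E → μ E < ∞ →
    ∃ C : ℝ≥0, ∀ f : R → ℝ≥0∞, Measurable f → ∫⁻ x in E, f x ∂μ ≤ (C : ℝ≥0∞) * ρ f

/-- Rearrangement invariance of a functional. -/
def IsRearrangementInvariant (μ : Measure R) (ρ : (R → ℝ≥0∞) → ℝ≥0∞) : Prop :=
  ∀ f g : R → ℝ≥0∞, Measurable f → Measurable g → Equimeasurable μ f g → ρ f = ρ g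

/-- The modulus of (the chosen measurable representative of) a class of complex functions. -/
noncomputable def modulus {μ : Measure R} (f : R →ₘ[μ] ℂ) (x : R) : ℝ≥0∞ := ‖f x‖ₑ

/-- The set of (classes of) functions at which the functional is finite. Functions at which a
quasi-Banach function norm, or its associate functional, is finite are finite almost everywhere,
so that nothing is lost by considering complex-valued functions only. -/
def finiteSet (μ : Measure R) (ρ : (R → ℝ≥0∞) → ℝ≥0∞) : Set (R →ₘ[μ] ℂ) :=
  {f | ρ (modulus f) < ∞}

/-- The associate functional; in `ℝ≥0∞` one has `0 / 0 = 0` and `a / 0 = ∞` for `a > 0`. -/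
noncomputable def associate (μ : Measure R) (ρ : (R → ℝ≥0∞) → ℝ≥0∞) (f : R → ℝ≥0∞) : ℝ≥0∞ :=
  ⨆ (g : R → ℝ≥0∞) (_ : Measurable g) (_ : ρ g < ∞), (∫⁻ x, f x * g x ∂μ) / ρ g

/-- The associate space `X'`. -/
def associateSpace (μ : Measure R) (ρ : (R → ℝ≥0∞) → ℝ≥0∞) : Set (R →ₘ[μ] ℂ) :=
  finiteSet μ (associate μ ρ)

/-- The (ACR) property: `f^*(t) → 0` as `t → ∞` for every `f ∈ X`. -/
def HasACR (μ : Measure R) (ρ : (R → ℝ≥0∞) → ℝ≥0∞) : Prop :=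
  ∀ f ∈ finiteSet μ ρ, Tendsto (rearrangement μ (modulus f)) atTop (𝓝 0)

section Facts

variable {μ : Measure R} {ρ : (R → ℝ≥0∞) → ℝ≥0∞}

theorem measurable_modulus (f : R →ₘ[μ] ℂ) : Measurable (modulus f) :=
  f.stronglyMeasurable.measurable.enorm

theorem modulus_add_le (f g : R →ₘ[μ] ℂ) :
    modulus (f + g) ≤ᵐ[μ] fun x => modulus f x + modulus g x := by
  filter_upwards [AEEqFun.coeFn_add f g] with x hx
  simpa [modulus, hx] using enorm_add_le (f x) (g x)

theorem modulus_smul (c : ℂ) (f : R →ₘ[μ] ℂ) :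
    modulus (c • f) =ᵐ[μ] fun x => (‖c‖₊ : ℝ≥0∞) * modulus f x := by
  filter_upwards [AEEqFun.coeFn_smul c f] with x hx
  simp [modulus, hx, enorm_eq_nnnorm]

theorem modulus_zero : modulus (0 : R →ₘ[μ] ℂ) =ᵐ[μ] 0 := by
  filter_upwards [AEEqFun.coeFn_zero (μ := μ) (α := R) (β := ℂ)] with x hx
  simp [modulus, hx]

theorem zero_mem_associateSpace : (0 : R →ₘ[μ] ℂ) ∈ associateSpace μ ρ := by
  have h : associate μ ρ (modulus (0 : R →ₘ[μ] ℂ)) = 0 := by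
    simp only [associate, ENNReal.iSup_eq_zero]
    intro g _ _
    have : ∫⁻ x, modulus (0 : R →ₘ[μ] ℂ) x * g x ∂μ = 0 := by
      rw [lintegral_congr_ae (g := fun _ => 0)]
      · simp
      · filter_upwards [modulus_zero (μ := μ)] with x hx
        simp [hx]
    simp [this]
  simp [associateSpace, finiteSet, h]

instance : Nonempty (associateSpace μ ρ) := ⟨⟨0, zero_mem_associateSpace⟩⟩

theorem rearrangementPairing_comm (f g : R → ℝ≥0∞) :
    rearrangementPairing μ f g = rearrangementPairing μ g f := by
  simp only [rearrangementPairing, mul_comm]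

theorem rearrangementPairing_lt_top (hμ : IsResonant μ) (hri : IsRearrangementInvariant μ ρ)
    {f g : R → ℝ≥0∞} (hf : Measurable f) (hg : Measurable g)
    (hfa : associate μ ρ f < ∞) (hgρ : ρ g < ∞) : rearrangementPairing μ f g < ∞ := by
  rw [← hμ f g hf hg]
  refine lt_of_le_of_lt (iSup_le fun h => iSup_le fun hh => iSup_le fun he => ?_)
    (ENNReal.mul_lt_top hfa hgρ)
  have e : ρ h = ρ g := hri h g hh hg he
  have hle : (∫⁻ x, f x * h x ∂μ) / ρ h ≤ associate μ ρ f :=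
    le_iSup_of_le h (le_iSup_of_le hh (le_iSup_of_le (e ▸ hgρ) le_rfl))
  rw [e] at hle
  exact (ENNReal.div_le_iff_le_mul (Or.inr hfa.ne) (Or.inl hgρ.ne)).1 hle

theorem rearrangementPairing_add_le (hμ : IsResonant μ) {φ f g h : R → ℝ≥0∞}
    (hφ : Measurable φ) (hf : Measurable f) (hg : Measurable g) (hh : Measurable h)
    (hle : h ≤ᵐ[μ] fun x => f x + g x) :
    rearrangementPairing μ φ h ≤ rearrangementPairing μ φ f + rearrangementPairing μ φ g := by
  rw [rearrangementPairing_comm φ h, rearrangementPairing_comm φ f,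
    rearrangementPairing_comm φ g, ← hμ h φ hh hφ, ← hμ f φ hf hφ, ← hμ g φ hg hφ]
  refine iSup_le fun ψ => iSup_le fun hψ => iSup_le fun he => ?_
  calc ∫⁻ x, h x * ψ x ∂μ ≤ ∫⁻ x, (f x * ψ x + g x * ψ x) ∂μ := by
        refine lintegral_mono_ae ?_
        filter_upwards [hle] with x hx
        rw [← add_mul]
        gcongr
    _ = ∫⁻ x, f x * ψ x ∂μ + ∫⁻ x, g x * ψ x ∂μ := lintegral_add_left (hf.mul hψ) _
    _ ≤ _ := by
        gcongr
        · exact le_iSup₂_of_le ψ hψ (le_iSup (fun _ => ∫⁻ x, f x * ψ x ∂μ) he)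
        · exact le_iSup₂_of_le ψ hψ (le_iSup (fun _ => ∫⁻ x, g x * ψ x ∂μ) he)

theorem rearrangementPairing_smul (hμ : IsResonant μ) {φ f h : R → ℝ≥0∞} (c : ℝ≥0)
    (hφ : Measurable φ) (hf : Measurable f) (hh : Measurable h)
    (he : h =ᵐ[μ] fun x => (c : ℝ≥0∞) * f x) :
    rearrangementPairing μ φ h = (c : ℝ≥0∞) * rearrangementPairing μ φ f := by
  rw [rearrangementPairing_comm φ h, rearrangementPairing_comm φ f,
    ← hμ h φ hh hφ, ← hμ f φ hf hφ]
  simp only [ENNReal.mul_iSup]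
  refine iSup_congr fun ψ => iSup_congr fun hψ => iSup_congr fun _ => ?_
  rw [← lintegral_const_mul (c : ℝ≥0∞) (f := fun x => f x * ψ x) (hf.mul hψ)]
  refine lintegral_congr_ae ?_
  filter_upwards [he] with x hx
  rw [hx, mul_assoc]

end Facts

section Space

variable {μ : Measure R} {ρ : (R → ℝ≥0∞) → ℝ≥0∞}

/-- The quasi-Banach function space `X = {f ; ‖f‖_X < ∞}` as a complex vector space. -/
def IsQuasiBanachFunctionNorm.space (hρ : IsQuasiBanachFunctionNorm μ ρ) :
    Submodule ℂ (R →ₘ[μ] ℂ) where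
  carrier := finiteSet μ ρ
  zero_mem' := by
    have h := (hρ.eq_zero_iff _ (measurable_modulus (0 : R →ₘ[μ] ℂ))).2 modulus_zero
    simp [finiteSet, h]
  add_mem' := by
    intro f g hf hg
    obtain ⟨C, -, hC⟩ := hρ.quasi_subadditive
    refine lt_of_le_of_lt ((hρ.lattice _ _ (measurable_modulus _)
      ((measurable_modulus f).add (measurable_modulus g)) (modulus_add_le f g)).trans
      (hC _ _ (measurable_modulus f) (measurable_modulus g))) ?_
    exact ENNReal.mul_lt_top ENNReal.coe_lt_top (ENNReal.add_lt_top.2 ⟨hf, hg⟩)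
  smul_mem' := by
    intro c f hf
    refine lt_of_le_of_lt ((hρ.lattice _ _ (measurable_modulus _)
      ((measurable_modulus f).const_mul _) (modulus_smul c f).le).trans_eq
      (hρ.homogeneous ‖c‖₊ _ (measurable_modulus f))) ?_
    exact ENNReal.mul_lt_top ENNReal.coe_lt_top hf

/-- The seminorm `|f|_φ = ∫_0^∞ φ^* f^* dλ` on `X`, for `φ ∈ X'`. -/
noncomputable def xiSeminorm (hμ : IsResonant μ) (hρ : IsQuasiBanachFunctionNorm μ ρ)
    (hri : IsRearrangementInvariant μ ρ) (φ : associateSpace μ ρ) : Seminorm ℂ hρ.space :=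
  Seminorm.of (fun f => (rearrangementPairing μ (modulus φ.1) (modulus f.1)).toReal)
    (by
      intro f g
      have hfin : ∀ u : hρ.space,
          rearrangementPairing μ (modulus φ.1) (modulus u.1) ≠ ∞ := fun u =>
        (rearrangementPairing_lt_top hμ hri (measurable_modulus _) (measurable_modulus _)
          φ.2 u.2).ne
      rw [← ENNReal.toReal_add (hfin f) (hfin g)]
      exact ENNReal.toReal_mono (ENNReal.add_ne_top.2 ⟨hfin f, hfin g⟩)
        (rearrangementPairing_add_le hμ (measurable_modulus _) (measurable_modulus _)
          (measurable_modulus _) (measurable_modulus _) (modulus_add_le f.1 g.1)))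
    (by
      intro c f
      have h := rearrangementPairing_smul hμ ‖c‖₊ (measurable_modulus φ.1)
        (measurable_modulus f.1) (measurable_modulus (c • f.1)) (modulus_smul c f.1)
      simp [h])

/-- The rearrangement-invariant locally convex topology `ξ` on `X`, induced by the family of
seminorms `|·|_φ`, `φ ∈ X'`. -/
@[reducible]
noncomputable def xiTopology (hμ : IsResonant μ) (hρ : IsQuasiBanachFunctionNorm μ ρ)
    (hri : IsRearrangementInvariant μ ρ) : TopologicalSpace hρ.space :=
  (SeminormFamily.moduleFilterBasis (𝕜 := ℂ) (xiSeminorm hμ hρ hri)).topology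

end Space

end RIFunctionSpace

/-! For `φ` in `X'`, resonance contains the Hardy–Littlewood inequality `∫ |φ f| ≤ ∫ φ^* f^*`, so
integration against `φ` is bounded by the single seminorm `|·|_φ`.

Conversely, let `α` be `ξ`-continuous. It is dominated by finitely many seminorms, and each of these
is at most a multiple of the quasi-norm, so `|α f| ≤ K ‖f‖_X` (`exists_enorm_le_of_continuous`). The
(ACR) property gives dominated convergence for `ξ`: under a majorant in `X`, level sets at positive
heights lie in a set of finite measure, so pointwise convergence forces the rearrangements of the
differences to 0 (`tendsto_rearrangementPairing_of_dominated`).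

Fix a nowhere vanishing `w` in `X`, which exists by `σ`-finiteness. By dominated convergence `E ↦
α(χ_E w)` is a complex measure on all measurable sets, and Radon–Nikodym gives an integrable density
`h`. The candidate is `φ = h / w`. Testing `α` on truncations gives `∫ |φ| g ≤ K ‖g‖_X`, hence `φ ∈
X'` (`lintegral_density_mul_le`); writing `f = (f / w) w` then gives `α f = ∫ φ f`. -/

namespace RIFunctionSpace

variable {R : Type*} [MeasurableSpace R] {μ : Measure R} {ρ : (R → ℝ≥0∞) → ℝ≥0∞}

/-! ### Rearrangements: dominated convergence and the Hardy–Littlewood inequality. -/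

section Rearrangement

theorem rearrangement_antitone (f : R → ℝ≥0∞) : Antitone (rearrangement μ f) := by
  intro t t' h
  exact le_iInf₂ fun s hs => iInf₂_le s (hs.trans (ENNReal.ofReal_le_ofReal h))

theorem rearrangement_le_of_distribution_le {f : R → ℝ≥0∞} {s : ℝ≥0} {t : ℝ}
    (h : distribution μ f s ≤ ENNReal.ofReal t) : rearrangement μ f t ≤ s :=
  iInf₂_le s h

theorem distribution_mono_ae {f g : R → ℝ≥0∞} (h : f ≤ᵐ[μ] g) (s : ℝ≥0) :
    distribution μ f s ≤ distribution μ g s := by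
  refine measure_mono_ae ?_
  filter_upwards [h] with x hx using fun hs => lt_of_lt_of_le hs hx

theorem rearrangement_mono_ae {f g : R → ℝ≥0∞} (h : f ≤ᵐ[μ] g) (t : ℝ) :
    rearrangement μ f t ≤ rearrangement μ g t :=
  le_iInf₂ fun s hs => iInf₂_le s ((distribution_mono_ae h s).trans hs)

theorem rearrangementPairing_mono_ae (φ : R → ℝ≥0∞) {f g : R → ℝ≥0∞} (h : f ≤ᵐ[μ] g) :
    rearrangementPairing μ φ f ≤ rearrangementPairing μ φ g :=
  lintegral_mono fun t => mul_le_mul_right (rearrangement_mono_ae h t) _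

/-- If `g^*(t) < s`, the infimum supplies a level `r < s` whose superlevel set has measure at most
`t`. -/
theorem distribution_lt_top_of_tendsto_rearrangement {g : R → ℝ≥0∞}
    (h : Tendsto (rearrangement μ g) atTop (𝓝 0)) {s : ℝ≥0} (hs : 0 < s) :
    distribution μ g s < ∞ := by
  obtain ⟨t, ht⟩ := (h.eventually (gt_mem_nhds (ENNReal.coe_pos.2 hs))).exists
  simp only [rearrangement, iInf_lt_iff] at ht
  obtain ⟨r, hr, hrs⟩ := ht
  refine lt_of_le_of_lt (le_trans ?_ hr) ENNReal.ofReal_lt_top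
  exact measure_mono fun x hx => hrs.trans hx

/-- The sets `{f i > s}` lie, up to null sets, in the finite-measure set `{g > s}`, and their
indicators tend to 0 almost everywhere. General countably generated filters are allowed because
unconditional sums later need limits along finite subsets of `ℕ`. -/
theorem tendsto_distribution_of_dominated {ι : Type*} {l : Filter ι} [l.IsCountablyGenerated]
    {f : ι → R → ℝ≥0∞} {g : R → ℝ≥0∞} (hf : ∀ i, Measurable (f i)) (hg : Measurable g)
    (hfg : ∀ i, f i ≤ᵐ[μ] g) (hlim : ∀ᵐ x ∂μ, Tendsto (fun i => f i x) l (𝓝 0))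
    {s : ℝ≥0} (hs : 0 < s) (hgs : distribution μ g s < ∞) :
    Tendsto (fun i => distribution μ (f i) s) l (𝓝 0) := by
  have key : Tendsto (fun i => μ ({x | (s : ℝ≥0∞) < f i x} ∩ {x | (s : ℝ≥0∞) < g x})) l
      (𝓝 (μ ∅)) := by
    refine tendsto_measure_of_ae_tendsto_indicator l MeasurableSet.empty
      (fun i => (measurableSet_lt measurable_const (hf i)).inter
        (measurableSet_lt measurable_const hg)) (measurableSet_lt measurable_const hg)
      hgs.ne (Eventually.of_forall fun i => Set.inter_subset_right) ?_
    filter_upwards [hlim] with x hx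
    filter_upwards [hx.eventually (gt_mem_nhds (ENNReal.coe_pos.2 hs))] with i hi
    simp only [Set.mem_inter_iff, Set.mem_ofPred_eq, Set.mem_empty_iff_false, iff_false, not_and]
    exact fun h => absurd h hi.not_gt
  rw [measure_empty] at key
  refine key.congr fun i => measure_congr ?_
  filter_upwards [hfg i] with x hx
  exact propext ⟨fun h => h.1, fun h => ⟨h, lt_of_lt_of_le h hx⟩⟩

theorem tendsto_rearrangement_of_dominated {ι : Type*} {l : Filter ι} [l.IsCountablyGenerated]
    {f : ι → R → ℝ≥0∞} {g : R → ℝ≥0∞} (hf : ∀ i, Measurable (f i)) (hg : Measurable g)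
    (hfg : ∀ i, f i ≤ᵐ[μ] g) (hlim : ∀ᵐ x ∂μ, Tendsto (fun i => f i x) l (𝓝 0))
    (hacr : Tendsto (rearrangement μ g) atTop (𝓝 0)) {t : ℝ} (ht : 0 < t) :
    Tendsto (fun i => rearrangement μ (f i) t) l (𝓝 0) := by
  rw [ENNReal.tendsto_nhds_zero]
  intro ε hε
  obtain ⟨s, hs, hsε⟩ := ENNReal.lt_iff_exists_nnreal_btwn.1 hε
  have hs' : 0 < s := ENNReal.coe_pos.1 hs
  have := tendsto_distribution_of_dominated hf hg hfg hlim hs'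
    (distribution_lt_top_of_tendsto_rearrangement hacr hs')
  filter_upwards [this.eventually (ge_mem_nhds (ENNReal.ofReal_pos.2 ht))] with i hi
  exact (rearrangement_le_of_distribution_le hi).trans hsε.le

/-- Dominated convergence for the pairing of rearrangements, for dominating functions whose
rearrangement vanishes at infinity. -/
theorem tendsto_rearrangementPairing_of_dominated {ι : Type*} {l : Filter ι}
    [l.IsCountablyGenerated] {φ : R → ℝ≥0∞} {f : ι → R → ℝ≥0∞} {g : R → ℝ≥0∞}
    (hf : ∀ i, Measurable (f i)) (hg : Measurable g)
    (hfg : ∀ i, f i ≤ᵐ[μ] g) (hlim : ∀ᵐ x ∂μ, Tendsto (fun i => f i x) l (𝓝 0))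
    (hacr : Tendsto (rearrangement μ g) atTop (𝓝 0))
    (hfin : rearrangementPairing μ φ g < ∞) :
    Tendsto (fun i => rearrangementPairing μ φ (f i)) l (𝓝 0) := by
  have hm : ∀ h : R → ℝ≥0∞, Measurable fun t => rearrangement μ φ t * rearrangement μ h t :=
    fun h => (rearrangement_antitone φ).measurable.mul (rearrangement_antitone h).measurable
  -- At `t = 0` the rearrangement is the essential supremum, which need not tend to 0; this point is
  -- negligible.
  have hpos : ∀ᵐ t ∂volume.restrict (Set.Ici (0 : ℝ)), 0 < t := by
    rw [← restrict_Ioi_eq_restrict_Ici]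
    exact ae_restrict_mem measurableSet_Ioi
  have := tendsto_lintegral_filter_of_dominated_convergence (l := l)
    (μ := volume.restrict (Set.Ici (0 : ℝ)))
    (F := fun i t => rearrangement μ φ t * rearrangement μ (f i) t) (f := fun _ => 0)
    (fun t => rearrangement μ φ t * rearrangement μ g t)
    (Eventually.of_forall fun i => hm (f i))
    (Eventually.of_forall fun i => Eventually.of_forall fun t =>
      mul_le_mul_right (rearrangement_mono_ae (hfg i) t) _) hfin.ne ?_
  · simpa [rearrangementPairing] using this
  filter_upwards [hpos, ae_lt_top (hm g) hfin.ne] with t ht hlt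
  -- Multiplication by `∞` is not continuous at 0, but finiteness of `φ^* g^*` at `t` forces `g^*(t)
  -- = 0`, and then every product vanishes.
  by_cases hφ : rearrangement μ φ t = ∞
  · have hg0 : rearrangement μ g t = 0 := by
      by_contra h0
      rw [hφ, ENNReal.top_mul h0] at hlt
      exact lt_irrefl _ hlt
    have : ∀ i, rearrangement μ (f i) t = 0 := fun i =>
      le_antisymm ((rearrangement_mono_ae (hfg i) t).trans hg0.le) (zero_le)
    simp only [this, mul_zero]
    exact tendsto_const_nhds
  · simpa using ENNReal.Tendsto.const_mul
      (tendsto_rearrangement_of_dominated hf hg hfg hlim hacr ht) (Or.inr hφ)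

theorem lintegral_mul_le_rearrangementPairing (hμ : IsResonant μ) {f g : R → ℝ≥0∞}
    (hf : Measurable f) (hg : Measurable g) :
    ∫⁻ x, f x * g x ∂μ ≤ rearrangementPairing μ f g := by
  rw [← hμ f g hf hg]
  exact le_iSup₂_of_le g hg (le_iSup (fun _ : Equimeasurable μ g g => ∫⁻ x, f x * g x ∂μ)
    fun _ _ => rfl)

/-- Resonance turns the pairing into a supremum over functions equimeasurable with `g`, all of which
have the quasi-norm of `g`. -/
theorem rearrangementPairing_le_associate_mul (hμ : IsResonant μ)
    (hri : IsRearrangementInvariant μ ρ) {f g : R → ℝ≥0∞} (hf : Measurable f) (hg : Measurable g)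
    (hfa : associate μ ρ f < ∞) (hgρ : ρ g < ∞) :
    rearrangementPairing μ f g ≤ associate μ ρ f * ρ g := by
  rw [← hμ f g hf hg]
  refine iSup_le fun h => iSup_le fun hh => iSup_le fun he => ?_
  have e : ρ h = ρ g := hri h g hh hg he
  have hle : (∫⁻ x, f x * h x ∂μ) / ρ h ≤ associate μ ρ f :=
    le_iSup_of_le h (le_iSup_of_le hh (le_iSup_of_le (e ▸ hgρ) le_rfl))
  rw [e] at hle
  exact (ENNReal.div_le_iff_le_mul (Or.inr hfa.ne) (Or.inl hgρ.ne)).1 hle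

end Rearrangement

/-! ### Series in the quasi-norm and a positive weight in `X`. -/

namespace IsQuasiBanachFunctionNorm

theorem congr_ae (hρ : IsQuasiBanachFunctionNorm μ ρ) {f g : R → ℝ≥0∞} (hf : Measurable f)
    (hg : Measurable g) (h : f =ᵐ[μ] g) : ρ f = ρ g :=
  le_antisymm (hρ.lattice f g hf hg h.le) (hρ.lattice g f hg hf h.symm.le)

/-- Peeling off the first summand, not the last, makes the factor of the `k`-th term independent of
`n`, so the bound survives passage to infinite series. -/
theorem sum_le {C : ℝ≥0}
    (hρ : IsQuasiBanachFunctionNorm μ ρ)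
    (hC : ∀ f g : R → ℝ≥0∞, Measurable f → Measurable g →
      ρ (fun x => f x + g x) ≤ (C : ℝ≥0∞) * (ρ f + ρ g)) (n : ℕ) :
    ∀ f : ℕ → R → ℝ≥0∞, (∀ k, Measurable (f k)) →
      ρ (fun x => ∑ k ∈ Finset.range n, f k x)
        ≤ ∑ k ∈ Finset.range n, (C : ℝ≥0∞) ^ (k + 1) * ρ (f k) := by
  induction n with
  | zero =>
    intro f _
    simpa using (hρ.eq_zero_iff (fun _ => 0) measurable_const).2 (ae_eq_refl _)
  | succ n ih =>
    intro f hf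
    simp only [Finset.sum_range_succ' _ n]
    refine (hC _ _ (Finset.measurable_sum _ fun k _ => hf (k + 1)) (hf 0)).trans ?_
    rw [mul_add, zero_add, pow_one]
    gcongr
    refine (mul_le_mul_right (ih (fun k => f (k + 1)) fun k => hf _) _).trans_eq ?_
    rw [Finset.mul_sum]
    exact Finset.sum_congr rfl fun k _ => by ring

/-- On a `σ`-finite measure space there is an everywhere positive function with finite
quasi-norm. -/
theorem exists_pos_lt_top [SigmaFinite μ] (hρ : IsQuasiBanachFunctionNorm μ ρ) :
    ∃ w : R → ℝ≥0, Measurable w ∧ (∀ x, 0 < w x) ∧ ρ (fun x => w x) < ∞ := by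
  obtain ⟨C, -, hC⟩ := hρ.quasi_subadditive
  set S := spanningSets μ
  have hS : ∀ n, MeasurableSet (S n) := measurableSet_spanningSets μ
  set a : ℕ → ℝ≥0∞ := fun n => ρ ((S n).indicator 1)
  have ha : ∀ n, a n < ∞ := fun n =>
    hρ.indicator_lt_top _ (hS n) (measure_spanningSets_lt_top μ n)
  -- The first part of the factor controls the quasi-norms of the partial sums; the added 1 gives `∑
  -- δ n < 1`, so that `W` is finite everywhere.
  obtain ⟨δ, hδ, hsum⟩ := ENNReal.exists_pos_tsum_mul_lt_of_countable one_ne_zero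
    (fun n => (C : ℝ≥0∞) ^ (n + 1) * a n + 1) (fun n =>
      ENNReal.add_ne_top.2 ⟨ENNReal.mul_ne_top (by finiteness) (ha n).ne, ENNReal.one_ne_top⟩)
  set f : ℕ → R → ℝ≥0∞ := fun n x => (δ n : ℝ≥0∞) * (S n).indicator 1 x
  have hf : ∀ n, Measurable (f n) := fun n => (measurable_one.indicator (hS n)).const_mul _
  set W : R → ℝ≥0∞ := fun x => ∑' n, f n x
  have hW : Measurable W := Measurable.tsum hf
  have hWfin : ∀ x, W x ≠ ∞ := by
    intro x
    refine (lt_of_le_of_lt (ENNReal.tsum_le_tsum fun n => ?_) (hsum.trans ENNReal.one_lt_top)).ne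
    rw [mul_comm]
    refine mul_le_mul_right (le_trans (b := (1 : ℝ≥0∞)) ?_ le_add_self) _
    exact Set.indicator_apply_le' (fun _ => le_rfl) fun _ => zero_le
  have hWpos : ∀ x, W x ≠ 0 := by
    intro x h
    obtain ⟨n, hn⟩ : ∃ n, x ∈ S n := by
      exact Set.mem_iUnion.1 ((iUnion_spanningSets μ).ge (Set.mem_univ x))
    have := ENNReal.tsum_eq_zero.1 h n
    simp [f, hn, (hδ n).ne'] at this
  have hρW : ρ W ≤ 1 := by
    have := (hρ.fatou (fun n x => ∑ k ∈ Finset.range n, f k x) W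
      (fun n => Finset.measurable_sum _ fun k _ => hf k) hW
      (Eventually.of_forall fun x => ⟨fun m n h => Finset.sum_le_sum_of_subset
        (Finset.range_mono h), ENNReal.tendsto_nat_tsum _⟩)).2
    refine le_of_tendsto' this fun n => (hρ.sum_le hC n f hf).trans ?_
    refine le_trans ?_ hsum.le
    refine le_trans (Finset.sum_le_sum fun k _ => ?_) (ENNReal.sum_le_tsum (Finset.range n))
    rw [hρ.homogeneous (δ k) _ (measurable_one.indicator (hS k)), mul_comm (δ k : ℝ≥0∞),
      ← mul_assoc]
    exact mul_le_mul_left le_self_add _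
  refine ⟨fun x => (W x).toNNReal, hW.ennreal_toNNReal,
    fun x => ENNReal.toNNReal_pos (hWpos x) (hWfin x), ?_⟩
  have e : (fun x => ((W x).toNNReal : ℝ≥0∞)) = W := funext fun x => ENNReal.coe_toNNReal (hWfin x)
  rw [e]
  exact hρW.trans_lt ENNReal.one_lt_top

end IsQuasiBanachFunctionNorm

/-! ### Densities of complex measures, and functions as elements of `X`. -/

/-- Radon--Nikodym for complex measures: absolutely continuous ones have integrable densities. -/
theorem exists_integrable_density [SigmaFinite μ] (ν : ComplexMeasure R)
    (hν : ∀ E, MeasurableSet E → μ E = 0 → ν E = 0) :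
    ∃ h : R → ℂ, Measurable h ∧ Integrable h μ ∧
      ∀ E, MeasurableSet E → ν E = ∫ x in E, h x ∂μ := by
  have hac : ∀ s : SignedMeasure R, (∀ E, ν E = 0 → s E = 0) →
      s ≪ᵥ μ.toENNRealVectorMeasure := fun s hs =>
    VectorMeasure.AbsolutelyContinuous.mk fun E hE h0 => hs E (hν E hE (by
      rwa [Measure.toENNRealVectorMeasure_apply_measurable hE] at h0))
  have hre := SignedMeasure.withDensityᵥ_rnDeriv_eq (ComplexMeasure.re ν) μ
    (hac _ fun E h => by
      change (ν E).re = 0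
      simp [h])
  have him := SignedMeasure.withDensityᵥ_rnDeriv_eq (ComplexMeasure.im ν) μ
    (hac _ fun E h => by
      change (ν E).im = 0
      simp [h])
  have ire := SignedMeasure.integrable_rnDeriv (ComplexMeasure.re ν) μ
  have iim := SignedMeasure.integrable_rnDeriv (ComplexMeasure.im ν) μ
  have mre := SignedMeasure.measurable_rnDeriv (ComplexMeasure.re ν) μ
  have mim := SignedMeasure.measurable_rnDeriv (ComplexMeasure.im ν) μ
  refine ⟨fun x => ((ComplexMeasure.re ν).rnDeriv μ x : ℂ)
      + ((ComplexMeasure.im ν).rnDeriv μ x : ℂ) * Complex.I,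
    by fun_prop, ire.ofReal.add (iim.ofReal.mul_const _), fun E hE => ?_⟩
  have ere : ∫ x in E, (ComplexMeasure.re ν).rnDeriv μ x ∂μ = (ν E).re := by
    rw [← withDensityᵥ_apply ire hE, hre]
    rfl
  have eim : ∫ x in E, (ComplexMeasure.im ν).rnDeriv μ x ∂μ = (ν E).im := by
    rw [← withDensityᵥ_apply iim hE, him]
    rfl
  rw [integral_add ire.ofReal.restrict (iim.ofReal.mul_const _).restrict,
    integral_mul_const, integral_complex_ofReal, integral_complex_ofReal, ere, eim,
    Complex.re_add_im]

theorem lintegral_mul_le_associate_mul {f g : R → ℝ≥0∞} (hg : Measurable g)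
    (hfa : associate μ ρ f < ∞) (hgρ : ρ g < ∞) :
    ∫⁻ x, f x * g x ∂μ ≤ associate μ ρ f * ρ g :=
  (ENNReal.div_le_iff_le_mul (Or.inr hfa.ne) (Or.inl hgρ.ne)).1
    (le_iSup_of_le g (le_iSup_of_le hg (le_iSup_of_le hgρ le_rfl)))

theorem modulus_mk {f : R → ℂ} (hf : AEStronglyMeasurable f μ) :
    modulus (AEEqFun.mk f hf) =ᵐ[μ] fun x => ‖f x‖ₑ := by
  filter_upwards [AEEqFun.coeFn_mk f hf] with x hx
  simp [modulus, hx]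

/-- Measurable complex functions with finite quasi-norm. -/
def FiniteNorm (ρ : (R → ℝ≥0∞) → ℝ≥0∞) (f : R → ℂ) : Prop :=
  Measurable f ∧ ρ (fun x => ‖f x‖ₑ) < ∞

theorem FiniteNorm.of_le (hρ : IsQuasiBanachFunctionNorm μ ρ) {f g : R → ℂ}
    (hg : FiniteNorm ρ g) (hf : Measurable f) (K : ℝ≥0) (h : ∀ x, ‖f x‖ ≤ K * ‖g x‖) :
    FiniteNorm ρ f := by
  refine ⟨hf, lt_of_le_of_lt (hρ.lattice _ _ hf.enorm (hg.1.enorm.const_mul (K : ℝ≥0∞))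
    (Eventually.of_forall fun x => ?_)) ?_⟩
  · simp only [enorm_eq_nnnorm]
    exact_mod_cast h x
  · rw [hρ.homogeneous K _ hg.1.enorm]
    exact ENNReal.mul_lt_top ENNReal.coe_lt_top hg.2

namespace IsQuasiBanachFunctionNorm

/-- The element of the space given by a measurable function of finite quasi-norm. -/
noncomputable def toSpace (hρ : IsQuasiBanachFunctionNorm μ ρ) (f : R → ℂ)
    (hf : FiniteNorm ρ f) : hρ.space :=
  ⟨AEEqFun.mk f hf.1.aestronglyMeasurable, by
    refine lt_of_le_of_lt (le_of_eq ?_) hf.2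
    exact hρ.congr_ae (measurable_modulus _) hf.1.enorm (modulus_mk _)⟩

theorem coeFn_toSpace (hρ : IsQuasiBanachFunctionNorm μ ρ) {f : R → ℂ} (hf : FiniteNorm ρ f) :
    ((hρ.toSpace f hf : R →ₘ[μ] ℂ) : R → ℂ) =ᵐ[μ] f :=
  AEEqFun.coeFn_mk _ _

theorem toSpace_eq (hρ : IsQuasiBanachFunctionNorm μ ρ) {f : R → ℂ} (hf : FiniteNorm ρ f)
    (g : hρ.space) (h : f =ᵐ[μ] (g : R →ₘ[μ] ℂ)) : hρ.toSpace f hf = g :=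
  Subtype.ext (AEEqFun.ext ((hρ.coeFn_toSpace hf).trans h))

/-- A separate `k`, equal to the sum only pointwise, lets this apply to indicators and products that
are not syntactically sums. -/
theorem toSpace_add (hρ : IsQuasiBanachFunctionNorm μ ρ) {f g k : R → ℂ} (hf : FiniteNorm ρ f)
    (hg : FiniteNorm ρ g) (hk : FiniteNorm ρ k) (h : ∀ x, k x = f x + g x) :
    hρ.toSpace k hk = hρ.toSpace f hf + hρ.toSpace g hg := by
  refine hρ.toSpace_eq hk _ ?_
  filter_upwards [AEEqFun.coeFn_add (hρ.toSpace f hf : R →ₘ[μ] ℂ) (hρ.toSpace g hg),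
    hρ.coeFn_toSpace hf, hρ.coeFn_toSpace hg] with x hx hxf hxg
  rw [h x, Submodule.coe_add, hx, Pi.add_apply, hxf, hxg]

theorem toSpace_smul (hρ : IsQuasiBanachFunctionNorm μ ρ) {f k : R → ℂ} (c : ℂ)
    (hf : FiniteNorm ρ f) (hk : FiniteNorm ρ k) (h : ∀ x, k x = c * f x) :
    hρ.toSpace k hk = c • hρ.toSpace f hf := by
  refine hρ.toSpace_eq hk _ ?_
  filter_upwards [AEEqFun.coeFn_smul c (hρ.toSpace f hf : R →ₘ[μ] ℂ),
    hρ.coeFn_toSpace hf] with x hx hxf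
  rw [h x, Submodule.coe_smul, hx, Pi.smul_apply, hxf, smul_eq_mul]

end IsQuasiBanachFunctionNorm

/-! ### Continuity and boundedness with respect to `ξ`. -/

section Topology

variable (hμ : IsResonant μ) (hρ : IsQuasiBanachFunctionNorm μ ρ)
  (hri : IsRearrangementInvariant μ ρ)

theorem withSeminorms_xiTopology :
    @WithSeminorms ℂ hρ.space (associateSpace μ ρ) _ _ _ (xiSeminorm hμ hρ hri)
      (xiTopology hμ hρ hri) :=
  let _ := xiTopology hμ hρ hri
  ⟨rfl⟩

theorem xiSeminorm_apply (φ : associateSpace μ ρ) (f : hρ.space) :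
    xiSeminorm hμ hρ hri φ f
      = (rearrangementPairing μ (modulus φ.1) (modulus f.1)).toReal := rfl

theorem norm_integral_mul_le_xiSeminorm (φ : associateSpace μ ρ) (f : hρ.space) :
    ‖∫ x, φ.1 x * (f : R →ₘ[μ] ℂ) x ∂μ‖ ≤ xiSeminorm hμ hρ hri φ f := by
  refine (norm_integral_le_lintegral_norm _).trans ?_
  rw [xiSeminorm_apply]
  refine ENNReal.toReal_mono (rearrangementPairing_lt_top hμ hri (measurable_modulus _)
    (measurable_modulus _) φ.2 f.2).ne (le_trans (le_of_eq ?_)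
    (lintegral_mul_le_rearrangementPairing hμ (measurable_modulus _) (measurable_modulus _)))
  simp [modulus]

theorem integrable_mul_of_mem_associateSpace {φ : R →ₘ[μ] ℂ} (hφ : φ ∈ associateSpace μ ρ)
    (f : hρ.space) : Integrable (fun x => φ x * (f : R →ₘ[μ] ℂ) x) μ := by
  refine ⟨φ.aestronglyMeasurable.mul (f : R →ₘ[μ] ℂ).aestronglyMeasurable, ?_⟩
  refine lt_of_le_of_lt (le_of_eq_of_le ?_ (lintegral_mul_le_associate_mul
    (measurable_modulus f.1) hφ f.2)) (ENNReal.mul_lt_top hφ f.2)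
  simp [modulus, enorm_mul]

theorem continuous_of_eq_integral {α : hρ.space →ₗ[ℂ] ℂ} (φ : associateSpace μ ρ)
    (h : ∀ f : hρ.space, α f = ∫ x, φ.1 x * (f : R →ₘ[μ] ℂ) x ∂μ) :
    Continuous[xiTopology hμ hρ hri, inferInstance] α := by
  let _ := xiTopology hμ hρ hri
  refine (withSeminorms_xiTopology hμ hρ hri).continuous_normedSpace_rng ℂ α ⟨{φ}, 1, fun f => ?_⟩
  have := norm_integral_mul_le_xiSeminorm hμ hρ hri φ f
  rw [← h f] at this
  simpa using this

variable {hμ hρ hri}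

/-- Continuity bounds `α` by a multiple of a finite supremum of seminorms, and each `|f|_φ` is at
most `‖φ‖_{X'} ‖f‖_X`; the sum over `s` dominates all the norms `‖φ‖_{X'}` at once. -/
theorem exists_enorm_le_of_continuous {α : hρ.space →ₗ[ℂ] ℂ}
    (hα : Continuous[xiTopology hμ hρ hri, inferInstance] α) :
    ∃ K : ℝ≥0, ∀ f : hρ.space, ‖α f‖ₑ ≤ K * ρ (modulus f.1) := by
  let _ := xiTopology hμ hρ hri
  obtain ⟨s, C, -, hC⟩ := Seminorm.bound_of_continuous (withSeminorms_xiTopology hμ hρ hri)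
    ((normSeminorm ℂ ℂ).comp α) (continuous_norm.comp hα)
  set a : associateSpace μ ρ → ℝ≥0 := fun φ => (associate μ ρ (modulus φ.1)).toNNReal
  refine ⟨C * ∑ φ ∈ s, a φ, fun f => ?_⟩
  set r : ℝ≥0 := (ρ (modulus f.1)).toNNReal
  have hr : ρ (modulus f.1) = r := (ENNReal.coe_toNNReal f.2.ne).symm
  have hle : s.sup (xiSeminorm hμ hρ hri) f ≤ (∑ φ ∈ s, a φ : ℝ≥0) * r := by
    refine Seminorm.finset_sup_apply_le (by positivity) fun φ hφ => ?_
    rw [xiSeminorm_apply]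
    have h1 := rearrangementPairing_le_associate_mul hμ hri (measurable_modulus φ.1)
      (measurable_modulus f.1) φ.2 f.2
    have h2 := ENNReal.toReal_mono (ENNReal.mul_ne_top φ.2.ne f.2.ne) h1
    rw [ENNReal.toReal_mul] at h2
    refine h2.trans (mul_le_mul_of_nonneg_right ?_ r.2)
    exact_mod_cast Finset.single_le_sum (f := a) (fun _ _ => zero_le) hφ
  have h := hC f
  have h' : ‖α f‖ ≤ C * s.sup (xiSeminorm hμ hρ hri) f := h
  have h3 : ‖α f‖₊ ≤ (C * ∑ φ ∈ s, a φ) * r := by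
    rw [← NNReal.coe_le_coe]
    push_cast
    rw [mul_assoc]
    refine h'.trans (mul_le_mul_of_nonneg_left ?_ C.2)
    exact_mod_cast hle
  rw [hr, enorm_eq_nnnorm]
  exact_mod_cast h3

/-- Dominated convergence for `ξ`-continuous functionals. -/
theorem tendsto_apply_toSpace_of_dominated (hACR : HasACR μ ρ) {α : hρ.space →ₗ[ℂ] ℂ}
    (hα : Continuous[xiTopology hμ hρ hri, inferInstance] α)
    {ι : Type*} {l : Filter ι} [l.IsCountablyGenerated]
    {f : ι → R → ℂ} (hf : ∀ i, FiniteNorm ρ (f i)) {f₀ : R → ℂ} (hf₀ : FiniteNorm ρ f₀)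
    {g : R → ℂ} (hg : FiniteNorm ρ g) (hle : ∀ i x, ‖f i x - f₀ x‖ ≤ ‖g x‖)
    (hlim : ∀ x, Tendsto (fun i => f i x) l (𝓝 (f₀ x))) :
    Tendsto (fun i => α (hρ.toSpace (f i) (hf i))) l (𝓝 (α (hρ.toSpace f₀ hf₀))) := by
  let _ := xiTopology hμ hρ hri
  have hp := withSeminorms_xiTopology hμ hρ hri
  refine (hα.tendsto _).comp ((hp.tendsto_nhds _ _).2 fun φ ε hε => ?_)
  set d : ι → hρ.space := fun i => hρ.toSpace (f i) (hf i) - hρ.toSpace f₀ hf₀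
  have hd : ∀ i, modulus (d i).1 =ᵐ[μ] fun x => ‖f i x - f₀ x‖ₑ := by
    intro i
    filter_upwards [AEEqFun.coeFn_sub (hρ.toSpace (f i) (hf i) : R →ₘ[μ] ℂ)
      (hρ.toSpace f₀ hf₀), hρ.coeFn_toSpace (hf i), hρ.coeFn_toSpace hf₀] with x hx h1 h2
    have e : (d i).1 x = f i x - f₀ x := by
      rw [← h1, ← h2]
      exact hx
    simp only [modulus, e]
  have hG := modulus_mk (μ := μ) hg.1.aestronglyMeasurable
  have hpair : Tendsto (fun i => rearrangementPairing μ (modulus φ.1)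
      (fun x => ‖f i x - f₀ x‖ₑ)) l (𝓝 0) := by
    refine tendsto_rearrangementPairing_of_dominated (g := modulus (hρ.toSpace g hg).1)
      (fun i => ((hf i).1.sub hf₀.1).enorm) (measurable_modulus _) (fun i => ?_) ?_
      (hACR _ (hρ.toSpace g hg).2) (rearrangementPairing_lt_top hμ hri (measurable_modulus _)
        (measurable_modulus _) φ.2 (hρ.toSpace g hg).2)
    · filter_upwards [hG] with x hx
      refine le_of_le_of_eq ?_ hx.symm
      exact enorm_le_iff_norm_le.2 (hle i x)
    · refine Eventually.of_forall fun x => ?_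
      have := ((hlim x).sub_const (f₀ x)).enorm
      simpa using this
  have hreal := (ENNReal.tendsto_toReal ENNReal.zero_ne_top).comp hpair
  filter_upwards [hreal.eventually (gt_mem_nhds hε)] with i hi
  refine lt_of_le_of_lt ?_ hi
  change xiSeminorm hμ hρ hri φ (d i) ≤ _
  rw [xiSeminorm_apply]
  exact (congrArg ENNReal.toReal (le_antisymm (rearrangementPairing_mono_ae _ (hd i).le)
    (rearrangementPairing_mono_ae _ (hd i).symm.le))).le

end Topology

/-! ### Representation of `α` on multiples of a weight `w`. -/

theorem FiniteNorm.indicator (hρ : IsQuasiBanachFunctionNorm μ ρ) {w : R → ℂ}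
    (hw : FiniteNorm ρ w) {E : Set R} (hE : MeasurableSet E) : FiniteNorm ρ (E.indicator w) :=
  hw.of_le hρ (hw.1.indicator hE) 1 fun x => by
    simpa using norm_indicator_le_norm_self w x

theorem FiniteNorm.simpleFunc_mul (hρ : IsQuasiBanachFunctionNorm μ ρ) {w : R → ℂ}
    (hw : FiniteNorm ρ w) (s : SimpleFunc R ℂ) : FiniteNorm ρ (fun x => s x * w x) := by
  obtain ⟨K, hK⟩ := s.exists_forall_norm_le
  refine hw.of_le hρ (s.measurable.mul hw.1) K.toNNReal fun x => ?_
  rw [norm_mul]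
  exact mul_le_mul_of_nonneg_right ((hK x).trans (Real.le_coe_toNNReal K)) (norm_nonneg _)

section Representation

variable {hμ : IsResonant μ} {hρ : IsQuasiBanachFunctionNorm μ ρ}
  {hri : IsRearrangementInvariant μ ρ} {α : hρ.space →ₗ[ℂ] ℂ} {w : R → ℂ}

theorem sum_apply_toSpace_indicator (α : hρ.space →ₗ[ℂ] ℂ) (hw : FiniteNorm ρ w)
    {A : ℕ → Set R} (hA : ∀ i, MeasurableSet (A i)) (hd : Pairwise (Function.onFun Disjoint A))
    (s : Finset ℕ) :
    ∑ i ∈ s, α (hρ.toSpace ((A i).indicator w) (hw.indicator hρ (hA i)))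
      = α (hρ.toSpace ((⋃ i ∈ s, A i).indicator w)
          (hw.indicator hρ (s.measurableSet_biUnion fun i _ => hA i))) := by
  induction s using Finset.induction_on with
  | empty =>
    rw [Finset.sum_empty, hρ.toSpace_smul 0 hw _ fun x => by simp, zero_smul, map_zero]
  | insert a s ha ih =>
    rw [Finset.sum_insert ha, ih, ← map_add]
    congr 1
    refine (hρ.toSpace_add _ _ _ fun x => ?_).symm
    have hdis : Disjoint (A a) (⋃ i ∈ s, A i) := by
      refine Set.disjoint_iUnion₂_right.2 fun i hi => hd ?_
      rintro rfl
      exact ha hi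
    rw [Finset.set_biUnion_insert, Set.indicator_union_of_disjoint hdis]

theorem hasSum_apply_toSpace_indicator (hACR : HasACR μ ρ)
    (hα : Continuous[xiTopology hμ hρ hri, inferInstance] α) (hw : FiniteNorm ρ w)
    {A : ℕ → Set R} (hA : ∀ i, MeasurableSet (A i)) (hd : Pairwise (Function.onFun Disjoint A)) :
    HasSum (fun i => α (hρ.toSpace ((A i).indicator w) (hw.indicator hρ (hA i))))
      (α (hρ.toSpace ((⋃ i, A i).indicator w) (hw.indicator hρ (MeasurableSet.iUnion hA)))) := by
  rw [HasSum]
  simp only [sum_apply_toSpace_indicator α hw hA hd]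
  -- Finite partial unions converge pointwise to the whole union along finite subsets of `ℕ`, with
  -- majorant `|w|`.
  refine tendsto_apply_toSpace_of_dominated hACR hα _ _ hw (fun s x => ?_) fun x => ?_
  · by_cases h1 : x ∈ ⋃ i ∈ s, A i
    · have h2 : x ∈ ⋃ i, A i := Set.iUnion₂_subset_iUnion _ _ h1
      simp only [Set.indicator_of_mem h1, Set.indicator_of_mem h2, sub_self, norm_zero]
      exact norm_nonneg _
    · rw [Set.indicator_of_notMem h1, zero_sub, norm_neg]
      exact norm_indicator_le_norm_self w x
  · refine tendsto_const_nhds.congr' ?_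
    by_cases h : x ∈ ⋃ i, A i
    · obtain ⟨i, hi⟩ := Set.mem_iUnion.1 h
      filter_upwards [eventually_ge_atTop {i}] with s hs
      rw [Set.indicator_of_mem h, Set.indicator_of_mem]
      exact Set.mem_iUnion₂.2 ⟨i, Finset.singleton_subset_iff.1 hs, hi⟩
    · refine Eventually.of_forall fun s => ?_
      simp only [Set.indicator_of_notMem h]
      refine (Set.indicator_of_notMem ?_ _).symm
      exact fun h' => h (Set.iUnion₂_subset_iUnion _ _ h')

/-- The weight puts `χ_E w` in `X` even when `E` has infinite measure, so one complex measure covers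
the whole space and no local densities need gluing. It vanishes on null sets because there `χ_E w`
is the zero class. -/
theorem exists_density_of_continuous [SigmaFinite μ] (hACR : HasACR μ ρ)
    (hα : Continuous[xiTopology hμ hρ hri, inferInstance] α) (hw : FiniteNorm ρ w) :
    ∃ h : R → ℂ, Measurable h ∧ Integrable h μ ∧ ∀ (E : Set R) (hE : MeasurableSet E),
      α (hρ.toSpace (E.indicator w) (hw.indicator hρ hE)) = ∫ x in E, h x ∂μ := by
  classical
  let ν : ComplexMeasure R :=
    { measureOf' := fun E => if hE : MeasurableSet E then
        α (hρ.toSpace (E.indicator w) (hw.indicator hρ hE)) else 0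
      empty' := by
        rw [dif_pos MeasurableSet.empty, hρ.toSpace_smul 0 hw _ fun x => by simp, zero_smul,
          map_zero]
      not_measurable' := fun E hE => dif_neg hE
      m_iUnion' := fun A hA hd => by
        simp only [dif_pos (hA _), dif_pos (MeasurableSet.iUnion hA)]
        exact hasSum_apply_toSpace_indicator hACR hα hw hA hd }
  have hν : ∀ (E : Set R) (hE : MeasurableSet E),
      ν E = α (hρ.toSpace (E.indicator w) (hw.indicator hρ hE)) := fun E hE => dif_pos hE
  obtain ⟨h, hm, hi, hE⟩ := exists_integrable_density (μ := μ) ν fun E hE h0 => by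
    rw [hν E hE, hρ.toSpace_eq (hw.indicator hρ hE) 0, map_zero]
    filter_upwards [measure_eq_zero_iff_ae_notMem.1 h0,
      AEEqFun.coeFn_zero (μ := μ) (α := R) (β := ℂ)] with x hx h0x
    rw [Set.indicator_of_notMem hx]
    exact h0x.symm
  exact ⟨h, hm, hi, fun E hE' => (hν E hE').symm.trans (hE E hE')⟩

theorem apply_toSpace_simpleFunc_mul (hw : FiniteNorm ρ w) {h : R → ℂ} (hi : Integrable h μ)
    (hE : ∀ (E : Set R) (hE : MeasurableSet E),
      α (hρ.toSpace (E.indicator w) (hw.indicator hρ hE)) = ∫ x in E, h x ∂μ)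
    (s : SimpleFunc R ℂ) :
    α (hρ.toSpace (fun x => s x * w x) (hw.simpleFunc_mul hρ s)) = ∫ x, s x * h x ∂μ := by
  induction s using SimpleFunc.induction with
  | @const c E hEm =>
    rw [hρ.toSpace_smul c (hw.indicator hρ hEm) _ fun x => by
      by_cases hx : x ∈ E <;> simp [hx], map_smul, hE E hEm, smul_eq_mul,
      ← integral_indicator hEm, ← integral_const_mul]
    refine integral_congr_ae (Eventually.of_forall fun x => ?_)
    by_cases hx : x ∈ E <;> simp [hx]
  | @add f g _ hf hg =>
    have hint : ∀ s : SimpleFunc R ℂ, Integrable (fun x => s x * h x) μ := fun s => by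
      obtain ⟨K, hK⟩ := s.exists_forall_norm_le
      exact hi.bdd_mul s.aestronglyMeasurable (Eventually.of_forall hK)
    rw [hρ.toSpace_add (hw.simpleFunc_mul hρ f) (hw.simpleFunc_mul hρ g) _ fun x => by
      simp [add_mul], map_add, hf, hg, ← integral_add (hint f) (hint g)]
    simp [add_mul]

/-- Approximate `u` by simple functions and pass to the limit twice: in `ξ` on the left, in `L^1` on
the right. -/
theorem apply_toSpace_mul (hACR : HasACR μ ρ)
    (hα : Continuous[xiTopology hμ hρ hri, inferInstance] α) (hw : FiniteNorm ρ w)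
    {h : R → ℂ} (hi : Integrable h μ)
    (hE : ∀ (E : Set R) (hE : MeasurableSet E),
      α (hρ.toSpace (E.indicator w) (hw.indicator hρ hE)) = ∫ x in E, h x ∂μ)
    {u : R → ℂ} (hu : Measurable u) (huw : FiniteNorm ρ (fun x => u x * w x))
    (huh : Integrable (fun x => u x * h x) μ) :
    α (hρ.toSpace (fun x => u x * w x) huw) = ∫ x, u x * h x ∂μ := by
  set s : ℕ → SimpleFunc R ℂ := SimpleFunc.approxOn u hu Set.univ 0 (Set.mem_univ _)
  have hs : ∀ n x, ‖s n x‖ ≤ 2 * ‖u x‖ := fun n x => by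
    rw [two_mul]
    exact SimpleFunc.norm_approxOn_zero_le hu (Set.mem_univ _) x n
  have hlim : ∀ x, Tendsto (fun n => s n x) atTop (𝓝 (u x)) := fun x =>
    SimpleFunc.tendsto_approxOn hu (Set.mem_univ _) (by simp)
  -- From `|s n| ≤ 2 |u|` one gets `|s n - u| ≤ 3 |u|`.
  have hg : FiniteNorm ρ (fun x => 3 * (u x * w x)) :=
    huw.of_le hρ (huw.1.const_mul 3) 3 fun x => by simp
  have h1 := tendsto_apply_toSpace_of_dominated hACR hα
    (fun n => hw.simpleFunc_mul hρ (s n)) huw hg (fun n x => by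
      rw [← sub_mul, norm_mul, norm_mul, norm_mul, ← mul_assoc]
      refine mul_le_mul_of_nonneg_right ((norm_sub_le _ _).trans ?_) (norm_nonneg _)
      have := hs n x
      norm_num
      linarith) fun x => (hlim x).mul_const (w x)
  refine tendsto_nhds_unique h1 ?_
  simp only [apply_toSpace_simpleFunc_mul hw hi hE]
  refine tendsto_integral_of_dominated_convergence (fun x => 2 * ‖u x * h x‖)
    (fun n => (s n).aestronglyMeasurable.mul hi.1) (huh.norm.const_mul 2)
    (fun n => Eventually.of_forall fun x => ?_)
    (Eventually.of_forall fun x => (hlim x).mul_const (h x))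
  rw [norm_mul, norm_mul, ← mul_assoc]
  exact mul_le_mul_of_nonneg_right (hs n x) (norm_nonneg _)

/-! ### Sign functions, membership of the density in `X'`, and uniqueness. -/

theorem measurable_conj_div_norm {h : R → ℂ} (hh : Measurable h) :
    Measurable fun x => starRingEnd ℂ (h x) / ‖h x‖ := by
  have : Measurable fun x => starRingEnd ℂ (h x) := Complex.continuous_conj.measurable.comp hh
  fun_prop

theorem conj_div_norm_mul_self (z : ℂ) : starRingEnd ℂ z / ‖z‖ * z = ‖z‖ := by
  by_cases hz : z = 0
  · simp [hz]
  have : (‖z‖ : ℂ) ≠ 0 := by simpa using hz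
  rw [div_mul_eq_mul_div, Complex.conj_mul', pow_two, mul_div_assoc, div_self this, mul_one]

theorem norm_conj_div_norm_le_one (z : ℂ) : ‖starRingEnd ℂ z / ‖z‖‖ ≤ 1 := by
  rw [norm_div, RCLike.norm_conj, Complex.norm_real, norm_norm]
  exact div_self_le_one _

/-- The quotient of the density by the weight is bounded against every `g` by the quasi-norm
of `g`, as one sees by testing the functional on the truncations `min g (n |w|)`. -/
theorem lintegral_density_mul_le (hACR : HasACR μ ρ)
    (hα : Continuous[xiTopology hμ hρ hri, inferInstance] α) (hw : FiniteNorm ρ w)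
    (hw0 : ∀ x, w x ≠ 0) {h : R → ℂ} (hm : Measurable h) (hi : Integrable h μ)
    (hE : ∀ (E : Set R) (hE : MeasurableSet E),
      α (hρ.toSpace (E.indicator w) (hw.indicator hρ hE)) = ∫ x in E, h x ∂μ)
    {K : ℝ≥0} (hK : ∀ f : hρ.space, ‖α f‖ₑ ≤ K * ρ (modulus f.1))
    {g : R → ℝ≥0∞} (hg : Measurable g) :
    ∫⁻ x, ‖h x / w x‖ₑ * g x ∂μ ≤ K * ρ g := by
  -- The cap `n |w|` makes `r n` finite even where `g = ∞`, and `r n / |w| ≤ n` is a bounded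
  -- multiplier.
  set r : ℕ → R → ℝ≥0∞ := fun n x => min (g x) (n * ‖w x‖ₑ)
  have hr : ∀ n, Measurable (r n) := fun n => hg.min (hw.1.enorm.const_mul _)
  have hrtop : ∀ n x, r n x ≠ ∞ := fun n x => ne_top_of_le_ne_top
    (ENNReal.mul_ne_top (ENNReal.natCast_ne_top n) enorm_ne_top) (min_le_right _ _)
  have hrle : ∀ n x, (r n x).toReal ≤ n * ‖w x‖ := fun n x => by
    have := ENNReal.toReal_mono (ENNReal.mul_ne_top (ENNReal.natCast_ne_top n) enorm_ne_top)
      (min_le_right (g x) (n * ‖w x‖ₑ))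
    simpa using this
  have step : ∀ n, ∫⁻ x, ‖h x / w x‖ₑ * r n x ∂μ ≤ K * ρ g := by
    intro n
    -- Chosen so that `|u w| ≤ r n` while `u h = |h / w| r n` is nonnegative: `α(u w)` is then
    -- exactly the integral to be bounded.
    set u : R → ℂ := fun x =>
      starRingEnd ℂ (h x) / ‖h x‖ * (((r n x).toReal / ‖w x‖ : ℝ) : ℂ)
    have hu : Measurable u := by
      refine (measurable_conj_div_norm hm).mul (Complex.measurable_ofReal.comp ?_)
      exact (hr n).ennreal_toReal.div hw.1.norm
    have hq : ∀ x, ‖(((r n x).toReal / ‖w x‖ : ℝ) : ℂ)‖ = (r n x).toReal / ‖w x‖ := fun x => by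
      rw [Complex.norm_real, Real.norm_of_nonneg (by positivity)]
    have hu1 : ∀ x, ‖u x‖ ≤ (r n x).toReal / ‖w x‖ := fun x => by
      rw [norm_mul, hq]
      exact mul_le_of_le_one_left (by positivity) (norm_conj_div_norm_le_one _)
    have hun : ∀ x, ‖u x‖ ≤ n := fun x =>
      (hu1 x).trans ((div_le_iff₀ (norm_pos_iff.2 (hw0 x))).2 (hrle n x))
    have huw : FiniteNorm ρ (fun x => u x * w x) :=
      hw.of_le hρ (hu.mul hw.1) n fun x => by
        rw [norm_mul]
        exact mul_le_mul_of_nonneg_right (by simpa using hun x) (norm_nonneg _)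
    have huwr : ∀ x, ‖u x * w x‖ₑ ≤ r n x := fun x => by
      rw [← ofReal_norm, norm_mul]
      refine (ENNReal.ofReal_le_ofReal (mul_le_mul_of_nonneg_right (hu1 x)
        (norm_nonneg _))).trans ?_
      rw [div_mul_cancel₀ _ (norm_ne_zero_iff.2 (hw0 x)), ENNReal.ofReal_toReal (hrtop n x)]
    have huh : Integrable (fun x => u x * h x) μ :=
      hi.bdd_mul hu.aestronglyMeasurable (Eventually.of_forall hun)
    have heq : ∀ x, u x * h x = ((‖h x / w x‖ * (r n x).toReal : ℝ) : ℂ) := fun x => by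
      have := conj_div_norm_mul_self (h x)
      calc u x * h x = (starRingEnd ℂ (h x) / ‖h x‖ * h x)
            * (((r n x).toReal / ‖w x‖ : ℝ) : ℂ) := by ring
        _ = _ := by
          rw [this, norm_div]
          push_cast
          ring
    have happ := apply_toSpace_mul hACR hα hw hi hE hu huw huh
    have hint : Integrable (fun x => ‖h x / w x‖ * (r n x).toReal) μ := by
      refine huh.norm.congr (Eventually.of_forall fun x => ?_)
      simp only [heq, Complex.norm_real]
      exact Real.norm_of_nonneg (by positivity)
    have hlin : ∫⁻ x, ‖h x / w x‖ₑ * r n x ∂μ = ‖α (hρ.toSpace _ huw)‖ₑ := by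
      rw [happ]
      simp only [heq]
      rw [integral_complex_ofReal, ← ofReal_norm, Complex.norm_real, Real.norm_of_nonneg
        (integral_nonneg fun x => by positivity), ofReal_integral_eq_lintegral_ofReal hint
        (Eventually.of_forall fun x => by positivity)]
      refine lintegral_congr fun x => ?_
      rw [ENNReal.ofReal_mul (norm_nonneg _), ofReal_norm, ENNReal.ofReal_toReal (hrtop n x)]
    rw [hlin]
    refine (hK _).trans (mul_le_mul_right ?_ _)
    refine hρ.lattice _ _ (measurable_modulus _) hg ?_
    filter_upwards [modulus_mk huw.1.aestronglyMeasurable] with x hx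
    exact (hx.le.trans (huwr x)).trans (min_le_left _ _)
  have hmono : ∀ x, Monotone fun n => r n x := fun x m n hmn =>
    min_le_min le_rfl (mul_le_mul_left (Nat.cast_le.2 hmn) _)
  have hsup : ∀ x, ⨆ n, r n x = g x := fun x => by
    refine tendsto_nhds_unique (tendsto_atTop_iSup (hmono x)) ?_
    have h1 : Tendsto (fun n : ℕ => (n : ℝ≥0∞) * ‖w x‖ₑ) atTop (𝓝 (∞ * ‖w x‖ₑ)) :=
      ENNReal.Tendsto.mul_const ENNReal.tendsto_nat_nhds_top (Or.inl ENNReal.top_ne_zero)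
    -- Since `w` vanishes nowhere, the caps tend to `∞` and the truncations recover all of `g`.
    rw [ENNReal.top_mul (enorm_ne_zero.2 (hw0 x))] at h1
    simpa using (tendsto_const_nhds (x := g x)).min h1
  calc ∫⁻ x, ‖h x / w x‖ₑ * g x ∂μ = ∫⁻ x, ⨆ n, ‖h x / w x‖ₑ * r n x ∂μ := by
        simp only [← ENNReal.mul_iSup, hsup]
    _ = ⨆ n, ∫⁻ x, ‖h x / w x‖ₑ * r n x ∂μ :=
        lintegral_iSup (fun n => (hm.div hw.1).enorm.mul (hr n))
          fun m n hmn x => mul_le_mul_right (hmono x hmn) _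
    _ ≤ K * ρ g := iSup_le step

theorem associate_le_of_forall_lintegral_le {f : R → ℝ≥0∞} {K : ℝ≥0∞}
    (h : ∀ g, Measurable g → ∫⁻ x, f x * g x ∂μ ≤ K * ρ g) : associate μ ρ f ≤ K :=
  iSup_le fun g => iSup_le fun hg => iSup_le fun _ => ENNReal.div_le_of_le_mul (h g hg)

theorem exists_finiteNorm_ne_zero [SigmaFinite μ] (hρ : IsQuasiBanachFunctionNorm μ ρ) :
    ∃ w : R → ℂ, FiniteNorm ρ w ∧ ∀ x, w x ≠ 0 := by
  obtain ⟨w, hm, hpos, hfin⟩ := hρ.exists_pos_lt_top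
  refine ⟨fun x => ((w x : ℝ) : ℂ), ⟨by fun_prop, ?_⟩, fun x => by
    simpa using (hpos x).ne'⟩
  refine lt_of_le_of_lt (le_of_eq ?_) hfin
  congr 1
  funext x
  simp [enorm_eq_nnnorm]

/-- Membership of `φ = h / w` in `X'` is established before the formula, since it supplies the
integrability of `(f / w) h = φ f` needed to represent `α f` for unbounded `f / w`. -/
theorem exists_eq_integral_of_continuous [SigmaFinite μ] (hACR : HasACR μ ρ)
    (hα : Continuous[xiTopology hμ hρ hri, inferInstance] α) :
    ∃ φ ∈ associateSpace μ ρ, ∀ f : hρ.space, α f = ∫ x, φ x * (f : R →ₘ[μ] ℂ) x ∂μ := by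
  obtain ⟨w, hw, hw0⟩ := exists_finiteNorm_ne_zero hρ
  obtain ⟨K, hK⟩ := exists_enorm_le_of_continuous hα
  obtain ⟨h, hm, hi, hE⟩ := exists_density_of_continuous hACR hα hw
  have hφm : Measurable fun x => h x / w x := hm.div hw.1
  set φ : R →ₘ[μ] ℂ := AEEqFun.mk _ hφm.aestronglyMeasurable
  have hφ : φ ∈ associateSpace μ ρ := by
    refine lt_of_le_of_lt (associate_le_of_forall_lintegral_le fun g hg => ?_)
      (ENNReal.coe_lt_top (r := K))
    refine le_of_eq_of_le (lintegral_congr_ae ?_)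
      (lintegral_density_mul_le hACR hα hw hw0 hm hi hE hK hg)
    filter_upwards [modulus_mk (μ := μ) hφm.aestronglyMeasurable] with x hx
    exact congrArg (· * g x) hx
  refine ⟨φ, hφ, fun f => ?_⟩
  have hfm : Measurable (f : R →ₘ[μ] ℂ) := (f : R →ₘ[μ] ℂ).stronglyMeasurable.measurable
  have huf : (fun x => (f : R →ₘ[μ] ℂ) x / w x * w x) = (f : R →ₘ[μ] ℂ) :=
    funext fun x => div_mul_cancel₀ _ (hw0 x)
  have huw : FiniteNorm ρ (fun x => (f : R →ₘ[μ] ℂ) x / w x * w x) := by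
    rw [huf]
    exact ⟨hfm, f.2⟩
  have hae : (fun x => φ x * (f : R →ₘ[μ] ℂ) x)
      =ᵐ[μ] fun x => (f : R →ₘ[μ] ℂ) x / w x * h x := by
    filter_upwards [AEEqFun.coeFn_mk _ hφm.aestronglyMeasurable] with x hx
    rw [hx]
    ring
  rw [integral_congr_ae hae, ← apply_toSpace_mul hACR hα hw hi hE
    (u := fun x => (f : R →ₘ[μ] ℂ) x / w x) (hfm.div hw.1) huw
    ((integrable_mul_of_mem_associateSpace hρ hφ f).congr hae),
    hρ.toSpace_eq huw f (by rw [huf])]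

theorem eq_of_forall_integral_mul_eq [SigmaFinite μ] (hρ : IsQuasiBanachFunctionNorm μ ρ)
    {φ ψ : R →ₘ[μ] ℂ} (hφ : φ ∈ associateSpace μ ρ)
    (hψ : ψ ∈ associateSpace μ ρ)
    (h : ∀ f : hρ.space, ∫ x, φ x * (f : R →ₘ[μ] ℂ) x ∂μ = ∫ x, ψ x * (f : R →ₘ[μ] ℂ) x ∂μ) :
    φ = ψ := by
  obtain ⟨w, hw, hw0⟩ := exists_finiteNorm_ne_zero hρ
  set d : R → ℂ := fun x => φ x - ψ x
  have hd : Measurable d := φ.stronglyMeasurable.measurable.sub ψ.stronglyMeasurable.measurable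
  -- This test function is bounded by `|w|`, hence lies in `X`, and `d u = |d| |w|`; its integral
  -- vanishes only if `d = 0` almost everywhere.
  set u : R → ℂ := fun x => starRingEnd ℂ (d x) / ‖d x‖ * ‖w x‖
  have hu : FiniteNorm ρ u := by
    have hwm : Measurable fun x => (‖w x‖ : ℂ) := Complex.measurable_ofReal.comp hw.1.norm
    refine hw.of_le hρ ((measurable_conj_div_norm hd).mul hwm) 1 fun x => ?_
    rw [norm_mul, Complex.norm_real, norm_norm]
    exact mul_le_mul_of_nonneg_right (norm_conj_div_norm_le_one _) (norm_nonneg _)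
  set f := hρ.toSpace u hu
  have hiφ := integrable_mul_of_mem_associateSpace hρ hφ f
  have hiψ := integrable_mul_of_mem_associateSpace hρ hψ f
  have hae : (fun x => φ x * (f : R →ₘ[μ] ℂ) x - ψ x * (f : R →ₘ[μ] ℂ) x)
      =ᵐ[μ] fun x => ((‖d x‖ * ‖w x‖ : ℝ) : ℂ) := by
    filter_upwards [hρ.coeFn_toSpace hu] with x hx
    rw [hx, ← sub_mul]
    push_cast
    rw [← conj_div_norm_mul_self (d x)]
    ring
  have h0 : ∫ x, ‖d x‖ * ‖w x‖ ∂μ = 0 := by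
    have := integral_sub hiφ hiψ
    rw [h f, sub_self, integral_congr_ae hae, integral_complex_ofReal] at this
    exact_mod_cast this
  have hint : Integrable (fun x => ‖d x‖ * ‖w x‖) μ := by
    have := ((hiφ.sub hiψ).congr hae).re
    simpa using this
  rw [integral_eq_zero_iff_of_nonneg (fun x => by positivity) hint] at h0
  refine AEEqFun.ext ?_
  filter_upwards [h0] with x hx
  have : d x = 0 := by simpa [hw0 x] using hx
  exact sub_eq_zero.1 this

end Representation

end RIFunctionSpace

/-! ### The duality theorem. -/

theorem mainTheorem6 {R : Type*} [MeasurableSpace R] (μ : Measure R) [SigmaFinite μ]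
    (hμ : RIFunctionSpace.IsResonant μ) (ρ : (R → ℝ≥0∞) → ℝ≥0∞)
    (hρ : RIFunctionSpace.IsQuasiBanachFunctionNorm μ ρ)
    (hri : RIFunctionSpace.IsRearrangementInvariant μ ρ)
    (hP5 : RIFunctionSpace.HasP5 μ ρ)
    (hACR : RIFunctionSpace.HasACR μ ρ) :
    (∀ φ ∈ RIFunctionSpace.associateSpace μ ρ, ∀ f : hρ.space,
      Integrable (fun x => φ x * (f : R →ₘ[μ] ℂ) x) μ) ∧
    ∀ α : hρ.space →ₗ[ℂ] ℂ,
      Continuous[RIFunctionSpace.xiTopology hμ hρ hri, inferInstance] α ↔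
        ∃! φ : R →ₘ[μ] ℂ, φ ∈ RIFunctionSpace.associateSpace μ ρ ∧
          ∀ f : hρ.space, α f = ∫ x, φ x * (f : R →ₘ[μ] ℂ) x ∂μ := by
  refine ⟨fun φ hφ f => RIFunctionSpace.integrable_mul_of_mem_associateSpace hρ hφ f,
    fun α => ⟨fun hα => ?_, ?_⟩⟩
  · obtain ⟨φ, hφ, h⟩ := RIFunctionSpace.exists_eq_integral_of_continuous hACR hα
    refine ⟨φ, ⟨hφ, h⟩, fun ψ hψ => ?_⟩
    exact RIFunctionSpace.eq_of_forall_integral_mul_eq hρ hψ.1 hφ fun f =>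
      (hψ.2 f).symm.trans (h f)
  · rintro ⟨φ, ⟨hφ, h⟩, -⟩
    exact RIFunctionSpace.continuous_of_eq_integral hμ hρ hri ⟨φ, hφ⟩ h
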